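/- A non-decreasing sequence of positive integers $a_1 \le a_2 \le \dots$ with $d = \gcd(a_1, a_2, \dots)$ is called asymptotically $m$-complete if there is $n_0$ such that for every integer $n \ge n_0$ the number $nd$ is a sum of $m$ terms $a_j$ with pairwise distinct indices. Theorem. Let $X_1, X_2, \dots$ be independent, identically distributed random variables with values in the positive integers, and let $W_n = X_1 + \dots + X_n$ for $n \ge 1$ be the sequence of weights with gaps $X_i$. Let $s_1, s_2, \dots$ be the (finitely or infinitely many) possible values of $X_1$, and let $p_i = P(X_1 = s_i) > 0$ be their probabilities. Put $$\rho = \inf_i \frac{-\log p_i}{s_i} \ge 0 .$$ Suppose that the moment generating function $M(t) = E[e^{tX_1}]$ has radius of convergence $R = \sup\{r \ge 0 : M(t) < \infty \text{ for all } |t| \le r\} \in [0, \infty]$ larger than $2\rho$. Then for every fixed integer $m \ge 2$, with probability $1$ the sequence $W_1, W_2, \dots$ is asymptotically $m$-complete. The hypothesis $R > 2\rho$ is satisfied if $X_1 - 1$ has the Poisson distribution with parameter $\lambda > 0$, and if $X_1$ has the geometric distribution $P(X_1 = k) = (1-p)^{k-1}p$, $k \ge 1$, with $\frac{\sqrt5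 - 1}{2} < p \le 1$. -/

import Mathlib

open MeasureTheory ProbabilityTheory
open scoped ENNReal NNReal

/-- A sequence `a` of natural numbers is asymptotically `k`-complete: it is a non-decreasing sequence
of positive integers and, with `d = gcd (a 0, a 1, …)`, every multiple `n * d` with `n` large enough is
a sum of `k` terms of the sequence with pairwise distinct indices. -/
def IsAsymptoticallyComplete (k : ℕ) (a : ℕ → ℕ) : Prop :=
  Monotone a ∧ (∀ i, 0 < a i) ∧
    ∃ n₀ : ℕ, ∀ n ≥ n₀, ∃ I : Finset ℕ,
      I.card = k ∧ ∑ i ∈ I, a i = n * Nat.setGcd (Set.range a)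

/-- The weights generated by the gaps `X 0, X 1, …`: the `j`-th weight (counted from `j = 0`) is
`X 0 + ⋯ + X j`. -/
def weight {Ω : Type*} (X : ℕ → Ω → ℕ) (ω : Ω) (j : ℕ) : ℕ :=
  ∑ i ∈ Finset.range (j + 1), X i ω

/-- `inf (-log p_s) / s`, the infimum being over the possible values `s` of the gap law `ν`
(those with `p_s = ν {s}` nonzero). -/
noncomputable def gapRate (ν : Measure ℕ) : ℝ :=
  ⨅ s : {s : ℕ // ν {s} ≠ 0}, -Real.log (ν.real {s.1}) / (s.1 : ℝ)

/-- The radius of convergence of the moment generating function `M t = ∑ s, p_s * exp (t * s)` of the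
law `ν`: the supremum in `[0, ∞]` of the `r ≥ 0` such that `M t` converges for all `|t| ≤ r`. -/
noncomputable def mgfRadius (ν : Measure ℕ) : ℝ≥0∞ :=
  ⨆ (r : ℝ≥0) (_ : Set.Icc (-(r : ℝ)) r ⊆ integrableExpSet (fun s : ℕ => (s : ℝ)) ν), (r : ℝ≥0∞)

/-- The hypothesis on the gap law: a probability distribution on the positive integers, whose moment
generating function has radius of convergence larger than `2 * inf (-log p_s) / s`. -/
structure IsAdmissibleGapLaw (ν : Measure ℕ) : Prop where
  isProbabilityMeasure : IsProbabilityMeasure ν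
  pos : ν {0} = 0
  radius : ENNReal.ofReal (2 * gapRate ν) < mgfRadius ν

/-! Fix a large multiple `N` of the gcd of the gap values and cap the gaps at `g = α log N`. For `t`
with `M(t) < ∞`, Chernoff's bound shows that some of the first O(N) gaps exceeds the cap with
probability O(N^(1 - αt)). Under the cap, the numbers `N - W_i` have no holes longer than `g`. So as
long as the walk is only slightly beyond `N / 2`, one of them lies at some distance `D₀ ≤ D ≤ D₀ +
g` ahead of it (`Unrepresented.exists_target`), and hitting it represents `N`. Mostly repeating one
nearly optimal gap value hits it with conditional probability at least a constant times N^(-αρ)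
(`exists_list_sum_eq_of_ge`). With αρ < β < 1, about N^β successive attempts all fail with
probability at most exp(-c N^(β - αρ)) (`measure_unrepresented_le`). Both error terms are summable
if αt > 2 and αρ < 1; such an `α` exists because t > 2ρ, which is where R > 2ρ enters.
Borel–Cantelli gives two weights (`ae_eventually_sum_two`); the other `m - 2` terms are the initial
weights. -/

/-! ### Gap rate and radius of convergence. -/

lemma gapRate_le {ν : Measure ℕ} [IsProbabilityMeasure ν] {s : ℕ} (hs : ν {s} ≠ 0) :
    gapRate ν ≤ -Real.log (ν.real {s}) / (s : ℝ) := by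
  refine ciInf_le ⟨0, ?_⟩ (⟨s, hs⟩ : {s : ℕ // ν {s} ≠ 0})
  rintro _ ⟨a, rfl⟩
  exact div_nonneg (neg_nonneg.2 (Real.log_nonpos measureReal_nonneg measureReal_le_one))
    (Nat.cast_nonneg _)

/-- The infimum need not be attained, so the main proof works with a nearly optimal value. Total
mass one makes the support nonempty; a real infimum over the empty type would be the default 0. -/
lemma gapRate_lt_exists {ν : Measure ℕ} [IsProbabilityMeasure ν] {c : ℝ} (hc : gapRate ν < c) :
    ∃ s : ℕ, ν {s} ≠ 0 ∧ -Real.log (ν.real {s}) / (s : ℝ) < c := by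
  have : Nonempty {s : ℕ // ν {s} ≠ 0} := by
    by_contra hne
    rw [not_nonempty_iff, isEmpty_subtype] at hne
    have h0 : ν Set.univ = 0 := by
      rw [← Set.iUnion_of_singleton, measure_iUnion_null_iff]
      exact fun s => not_not.1 (hne s)
    simp at h0
  obtain ⟨⟨s, hs⟩, h⟩ := exists_lt_of_ciInf_lt hc
  exact ⟨s, hs, h⟩

/-- Since the gaps are nonnegative, one point of convergence bounds the radius from below. -/
lemma ofReal_le_mgfRadius {ν : Measure ℕ} {r : ℝ} (hr : 0 ≤ r)
    (h : Integrable (fun s : ℕ => Real.exp (r * s)) ν) : ENNReal.ofReal r ≤ mgfRadius ν := by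
  refine le_iSup₂_of_le (f := fun (r : ℝ≥0) (_ : Set.Icc (-(r : ℝ)) r ⊆
    integrableExpSet (fun s : ℕ => (s : ℝ)) ν) => (r : ℝ≥0∞)) r.toNNReal ?_ le_rfl
  intro t ht
  rw [Real.coe_toNNReal r hr] at ht
  refine h.mono' (measurable_of_countable _).aestronglyMeasurable (ae_of_all _ fun s => ?_)
  rw [Real.norm_eq_abs, Real.abs_exp, Real.exp_le_exp]
  exact mul_le_mul_of_nonneg_right ht.2 (Nat.cast_nonneg s)

lemma exists_integrable_exp_of_lt_mgfRadius {ν : Measure ℕ} {a : ℝ}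
    (h : ENNReal.ofReal a < mgfRadius ν) :
    ∃ t : ℝ, 0 < t ∧ a < t ∧ Integrable (fun s : ℕ => Real.exp (t * s)) ν := by
  obtain ⟨r, hr⟩ := lt_iSup_iff.1 h
  obtain ⟨hsub, hr⟩ := lt_iSup_iff.1 hr
  have h0 : 0 < r := by
    rw [← ENNReal.coe_pos]
    exact lt_of_le_of_lt bot_le hr
  refine ⟨r, h0, ?_, hsub ⟨by linarith [r.coe_nonneg], le_rfl⟩⟩
  rw [← ENNReal.ofReal_coe_nnreal] at hr
  exact (ENNReal.ofReal_lt_ofReal_iff h0).1 hr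

/-! ### The Poisson and geometric examples. -/

lemma map_succ_singleton_zero (ν : Measure ℕ) : ν.map (fun k => k + 1) {0} = 0 := by
  rw [Measure.map_apply (measurable_of_countable _) (measurableSet_singleton 0)]
  convert measure_empty (μ := ν)
  ext; simp

theorem isAdmissibleGapLaw_poisson (r : ℝ≥0) :
    IsAdmissibleGapLaw ((poissonMeasure r).map (fun k => k + 1)) where
  isProbabilityMeasure := Measure.isProbabilityMeasure_map (measurable_of_countable _).aemeasurable
  pos := map_succ_singleton_zero _
  radius := by
    have key (t : ℝ) (ht : 0 ≤ t) :
        ENNReal.ofReal t ≤ mgfRadius ((poissonMeasure r).map (fun k => k + 1)) := by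
      refine ofReal_le_mgfRadius ht ?_
      rw [integrable_map_measure .of_discrete .of_discrete, integrable_poissonMeasure_iff]
      have := (Real.summable_pow_div_factorial (r * Real.exp t)).mul_left
        (Real.exp (-r) * Real.exp t)
      convert! this using 2 with n
      simp only [Function.comp, Real.norm_eq_abs, Real.abs_exp]
      push_cast
      rw [mul_add, Real.exp_add, mul_comm t n, Real.exp_nat_mul, mul_pow]
      ring_nf
    set a := 2 * gapRate ((poissonMeasure r).map (fun k => k + 1))
    refine lt_of_lt_of_le ?_ (key (|a| + 1) (by positivity))
    exact (ENNReal.ofReal_lt_ofReal_iff (by positivity)).2 (by linarith [le_abs_self a])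

theorem isAdmissibleGapLaw_geometric (p : unitInterval) (hp : (Real.sqrt 5 - 1) / 2 < (p : ℝ)) :
    IsAdmissibleGapLaw ((geometricMeasure p).map (fun k => k + 1)) where
  isProbabilityMeasure := Measure.isProbabilityMeasure_map (measurable_of_countable _).aemeasurable
  pos := map_succ_singleton_zero _
  radius := by
    set ν := (geometricMeasure p).map (fun k => k + 1)
    have : IsProbabilityMeasure ν :=
      Measure.isProbabilityMeasure_map (measurable_of_countable _).aemeasurable
    have h5 : (1 : ℝ) < Real.sqrt 5 := by
      rw [Real.lt_sqrt (by norm_num)]; norm_num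
    have hp0 : (0 : ℝ) < p := by linarith
    have hpne : p ≠ 0 := fun h => by simp [h] at hp0
    have hp1 : (p : ℝ) ≤ 1 := p.2.2
    have hsq : 1 - (p : ℝ) < (p : ℝ) ^ 2 := by
      nlinarith [Real.sq_sqrt (show (0 : ℝ) ≤ 5 by norm_num)]
    -- The series converges for e^t < 1 / (1 - p); taking t = -log y with y strictly above 1 - p
    -- also covers p = 1.
    obtain ⟨y, hy1, hy2⟩ := exists_between hsq
    have hy0 : 0 < y := by linarith
    have hone : ν {1} = ENNReal.ofReal p := by
      rw [Measure.map_apply (measurable_of_countable _) (measurableSet_singleton 1)]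
      have : (fun k : ℕ => k + 1) ⁻¹' {1} = {0} := by ext; simp
      rw [this, geometricMeasure_singleton hpne]
      simp
    have hrate : gapRate ν ≤ -Real.log p := by
      refine (gapRate_le (s := 1) ?_).trans_eq ?_
      · rw [hone]; simpa using hp0
      · rw [measureReal_def, hone, ENNReal.toReal_ofReal hp0.le]; simp
    have hlog : 2 * gapRate ν < -Real.log y := by
      have := Real.log_lt_log hy0 hy2
      rw [Real.log_pow] at this
      push_cast at this
      linarith
    have hylog : 0 < -Real.log y := by
      have : y < 1 := hy2.trans_le (pow_le_one₀ hp0.le hp1)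
      linarith [Real.log_neg hy0 this]
    refine lt_of_lt_of_le ((ENNReal.ofReal_lt_ofReal_iff hylog).2 hlog) ?_
    refine ofReal_le_mgfRadius hylog.le ?_
    rw [integrable_map_measure .of_discrete .of_discrete, integrable_geometricMeasure_iff hpne]
    have hs : Summable fun n : ℕ => ((1 - (p : ℝ)) / y) ^ n :=
      summable_geometric_of_lt_one (div_nonneg (by linarith) hy0.le) ((div_lt_one hy0).2 hy1)
    convert! hs.mul_left (p / y : ℝ) using 2 with n
    simp only [Function.comp, Real.norm_eq_abs, Real.abs_exp]
    have : Real.exp (-Real.log y * ((n + 1 : ℕ) : ℝ)) = (y ^ (n + 1))⁻¹ := by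
      rw [neg_mul, Real.exp_neg, mul_comm, Real.exp_nat_mul, Real.exp_log hy0]
    rw [this, div_pow]
    field_simp
    ring

/-! ### Finite gap histories and conditioning on them. -/

/-- The first `n` gaps. -/
def gapHistory {Ω : Type*} (X : ℕ → Ω → ℕ) (n : ℕ) (ω : Ω) : List ℕ :=
  (List.range n).map fun i => X i ω

lemma gapHistory_length {Ω : Type*} (X : ℕ → Ω → ℕ) (n : ℕ) (ω : Ω) :
    (gapHistory X n ω).length = n := by
  simp [gapHistory]

lemma gapHistory_eq_iff {Ω : Type*} {X : ℕ → Ω → ℕ} {n : ℕ} {ω ω' : Ω} :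
    gapHistory X n ω' = gapHistory X n ω ↔ ∀ i < n, X i ω' = X i ω := by
  simp [gapHistory]

lemma gapHistory_eq_append {Ω : Type*} {X : ℕ → Ω → ℕ} {n : ℕ} {ω ω' : Ω} {l : List ℕ}
    (h : gapHistory X (n + l.length) ω' = gapHistory X n ω ++ l) :
    gapHistory X n ω' = gapHistory X n ω ∧
      ((List.range l.length).map fun i => X (n + i) ω') = l := by
  rw [gapHistory, List.range_add, List.map_append] at h
  have := List.append_inj h (by simp [gapHistory])
  refine ⟨this.1, ?_⟩
  simpa [Function.comp_def] using this.2

lemma setOf_gapHistory_eq {Ω : Type*} (X : ℕ → Ω → ℕ) (L : List ℕ) :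
    {ω | gapHistory X L.length ω = L} =
      ⋂ i ∈ Finset.range L.length, X i ⁻¹' {L.getD i 0} := by
  ext ω
  simp only [Set.mem_ofPred_eq, Set.mem_iInter, Finset.mem_range, Set.mem_preimage,
    Set.mem_singleton_iff]
  rw [List.ext_getElem_iff]
  simp only [gapHistory_length, true_and]
  refine ⟨fun h i hi => ?_, fun h i hi hi' => ?_⟩
  · have := h i hi hi
    simp only [gapHistory, List.getElem_map, List.getElem_range] at this
    rw [this, List.getD_eq_getElem _ _ hi]
  · have := h i hi
    simp only [gapHistory, List.getElem_map, List.getElem_range]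
    rw [this, List.getD_eq_getElem _ _ hi]

section Independence

variable {Ω : Type*} [MeasurableSpace Ω] {μ : Measure Ω} {X : ℕ → Ω → ℕ} {ν : Measure ℕ}

lemma measurableSet_gapHistory_eq (hm : ∀ i, Measurable (X i)) (L : List ℕ) :
    MeasurableSet {ω | gapHistory X L.length ω = L} := by
  rw [setOf_gapHistory_eq]
  exact Finset.measurableSet_biInter _ fun i _ => hm i (measurableSet_singleton _)

lemma measure_gapHistory_eq (hm : ∀ i, Measurable (X i)) (hi : iIndepFun X μ)
    (hl : ∀ i, μ.map (X i) = ν) (L : List ℕ) :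
    μ {ω | gapHistory X L.length ω = L} = (L.map fun a => ν {a}).prod := by
  rw [setOf_gapHistory_eq, hi.measure_inter_preimage_eq_mul (Finset.range L.length)
    (sets := fun i => {L.getD i 0}) fun i _ => measurableSet_singleton _]
  have (i : ℕ) : μ (X i ⁻¹' {L.getD i 0}) = ν {L.getD i 0} := by
    rw [← hl i, Measure.map_apply (hm i) (measurableSet_singleton _)]
  simp only [this]
  rw [Finset.prod_range, ← List.prod_ofFn]
  congr 1
  refine List.ext_getElem (by simp) fun i h1 h2 => ?_
  simp at h1 h2
  simp

/-- If every history in `A` has a continuation of conditional probability at least `q` that leads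
outside of `A'`, then `A'` is smaller than `A` by the factor `1 - q`. -/
lemma measure_le_of_forbidden_continuation [IsProbabilityMeasure μ]
    (hm : ∀ i, Measurable (X i)) (hi : iIndepFun X μ)
    (hl : ∀ i, μ.map (X i) = ν) {A A' : Set Ω} {n : ℕ} {q : ℝ≥0∞} (hsub : A' ⊆ A)
    (hdep : ∀ ω ∈ A, ∀ ω', gapHistory X n ω' = gapHistory X n ω → ω' ∈ A)
    (hext : ∀ ω ∈ A, ∃ l : List ℕ, q ≤ (l.map fun a => ν {a}).prod ∧
      ∀ ω', gapHistory X (n + l.length) ω' = gapHistory X n ω ++ l → ω' ∉ A') :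
    μ A' ≤ (1 - q) * μ A := by
  set H : Set (List ℕ) := gapHistory X n '' A with hH
  -- The set `A` is a disjoint union of these countably many cylinders, so the estimate is proved on
  -- each and summed; `A'` need not be measurable.
  set C : H → Set Ω := fun L => {ω | gapHistory X n ω = L}
  have hC (L : H) : C L = {ω | gapHistory X L.1.length ω = L} := by
    obtain ⟨_, ω, hω, rfl⟩ := L
    simp [C, gapHistory_length]
  have hCm (L : H) : MeasurableSet (C L) := by
    rw [hC]; exact measurableSet_gapHistory_eq hm _
  have hpiece (L : H) : μ (A' ∩ C L) ≤ (1 - q) * μ (C L) := by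
    obtain ⟨_, ω, hω, rfl⟩ := L
    obtain ⟨l, hql, hl'⟩ := hext ω hω
    set L := gapHistory X n ω with hL
    have hlen : L.length = n := gapHistory_length X n ω
    set E : Set Ω := {ω | gapHistory X (L ++ l).length ω = L ++ l}
    have hEm : MeasurableSet E := measurableSet_gapHistory_eq hm _
    have hEsub : E ⊆ C ⟨L, ω, hω, rfl⟩ := by
      intro ω' hω'
      have : gapHistory X (n + l.length) ω' = L ++ l := by
        simpa [E, List.length_append, hlen] using hω'
      exact (gapHistory_eq_append this).1
    have hE : μ E = μ (C ⟨L, ω, hω, rfl⟩) * (l.map fun a => ν {a}).prod := by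
      rw [hC, measure_gapHistory_eq hm hi hl, measure_gapHistory_eq hm hi hl]
      simp
    calc μ (A' ∩ C ⟨L, ω, hω, rfl⟩) ≤ μ (C ⟨L, ω, hω, rfl⟩ \ E) := by
          refine measure_mono fun ω' hω' => ⟨hω'.2, fun hE' => hl' ω' ?_ hω'.1⟩
          simpa [E, List.length_append, hlen] using hE'
      _ = μ (C ⟨L, ω, hω, rfl⟩) - μ E :=
          measure_sdiff hEsub hEm.nullMeasurableSet (measure_ne_top _ _)
      _ ≤ μ (C ⟨L, ω, hω, rfl⟩) - q * μ (C ⟨L, ω, hω, rfl⟩) := by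
          refine tsub_le_tsub_left ?_ _
          rw [hE, mul_comm]
          gcongr
      _ = (1 - q) * μ (C ⟨L, ω, hω, rfl⟩) := by
          rw [ENNReal.sub_mul fun _ _ => measure_ne_top _ _, one_mul]
  have hdisj : Pairwise (Function.onFun Disjoint C) := by
    intro L L' hne
    refine Set.disjoint_left.2 fun ω h h' => hne (Subtype.ext ?_)
    exact (show gapHistory X n ω = L from h).symm.trans h'
  calc μ A' ≤ μ (⋃ L, A' ∩ C L) := by
        refine measure_mono fun ω hω => Set.mem_iUnion.2 ⟨⟨_, ω, hsub hω, rfl⟩, hω, rfl⟩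
    _ ≤ ∑' L, μ (A' ∩ C L) := measure_iUnion_le _
    _ ≤ ∑' L, (1 - q) * μ (C L) := ENNReal.tsum_le_tsum hpiece
    _ = (1 - q) * μ (⋃ L, C L) := by rw [ENNReal.tsum_mul_left, measure_iUnion hdisj hCm]
    _ ≤ (1 - q) * μ A := by
        gcongr
        refine Set.iUnion_subset ?_
        rintro ⟨_, ω, hω, rfl⟩ ω' hω'
        exact hdep ω hω ω' hω'

end Independence

/-! ### Deterministic analysis of a path. -/

/-- The sum of the gaps `x 0, …, x j`. -/
def gapSum (x : ℕ → ℕ) (j : ℕ) : ℕ := ∑ i ∈ Finset.range (j + 1), x i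

lemma gapSum_succ (x : ℕ → ℕ) (j : ℕ) : gapSum x (j + 1) = gapSum x j + x (j + 1) :=
  Finset.sum_range_succ _ _

lemma gapSum_mono (x : ℕ → ℕ) : Monotone (gapSum x) :=
  monotone_nat_of_le_succ fun j => by rw [gapSum_succ]; omega

lemma gapSum_congr {x y : ℕ → ℕ} {j : ℕ} (h : ∀ i ≤ j, x i = y i) : gapSum x j = gapSum y j :=
  Finset.sum_congr rfl fun i hi => h i (by simpa [Nat.lt_succ_iff] using hi)

lemma gapSum_add_le {x : ℕ → ℕ} {g k r : ℕ} (h : ∀ i ≤ k + r, x i ≤ g) :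
    gapSum x (k + r) ≤ gapSum x k + r * g := by
  induction r with
  | zero => simp
  | succ r ih =>
    rw [← add_assoc, gapSum_succ, add_mul]
    have := ih fun i hi => h i (by omega)
    have := h (k + r + 1) (by omega)
    omega

lemma gapSum_le {x : ℕ → ℕ} {g k : ℕ} (h : ∀ i ≤ k, x i ≤ g) : gapSum x k ≤ (k + 1) * g := by
  have := gapSum_add_le (x := x) (g := g) (k := 0) (r := k) (by simpa using h)
  have h0 := h 0 (by omega)
  simp only [zero_add] at this
  simp [gapSum] at this h0 ⊢
  linarith

lemma lt_gapSum {x : ℕ → ℕ} {k : ℕ} (h : ∀ i ≤ k, 0 < x i) : k < gapSum x k := by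
  induction k with
  | zero => simpa [gapSum] using h 0 le_rfl
  | succ k ih =>
    rw [gapSum_succ]
    have := ih fun i hi => h i (by omega)
    have := h (k + 1) le_rfl
    omega

lemma gapSum_add_list {x : ℕ → ℕ} {k : ℕ} {l : List ℕ}
    (h : ((List.range l.length).map fun i => x (k + 1 + i)) = l) :
    gapSum x (k + l.length) = gapSum x k + l.sum := by
  rw [gapSum, show k + l.length + 1 = (k + 1) + l.length by ring, Finset.sum_range_add, ← h]
  simp only [List.length_map, List.length_range, gapSum]
  congr 1

/-- The first `n` gaps lie in `S` and are at most `g`, the weight of index `k` is the first one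
beyond `N / 2`, or shortly after, and no two of the weights of indices `K, …, n - 1` add up to
`N`. -/
def Unrepresented (S : Set ℕ) (g K N k n : ℕ) (x : ℕ → ℕ) : Prop :=
  (∀ i < n, x i ∈ S ∧ x i ≤ g) ∧ N < 2 * gapSum x k ∧ 2 * gapSum x k ≤ N + 2 * g ∧
    ∀ i j, K ≤ i → i < j → j < n → gapSum x i + gapSum x j ≠ N

/-- Being unrepresented depends only on the first `n` gaps, as conditioning on the history requires.
-/
lemma Unrepresented.congr {S : Set ℕ} {g K N k n : ℕ} {x y : ℕ → ℕ} (hk : k < n)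
    (h : Unrepresented S g K N k n x) (hxy : ∀ i < n, y i = x i) :
    Unrepresented S g K N k n y := by
  have hs (j : ℕ) (hj : j < n) : gapSum y j = gapSum x j :=
    gapSum_congr fun i hi => hxy i (by omega)
  refine ⟨fun i hi => hxy i hi ▸ h.1 i hi, hs k hk ▸ h.2.1, hs k hk ▸ h.2.2.1,
    fun i j hi hij hj => ?_⟩
  rw [hs i (by omega), hs j hj]
  exact h.2.2.2 i j hi hij hj

lemma Unrepresented.mono {S : Set ℕ} {g K N k n n' : ℕ} {x : ℕ → ℕ} (hn : n ≤ n')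
    (h : Unrepresented S g K N k n' x) : Unrepresented S g K N k n x :=
  ⟨fun i hi => h.1 i (by omega), h.2.1, h.2.2.1, fun i j hi hij hj =>
    h.2.2.2 i j hi hij (by omega)⟩

lemma dvd_gapSum {x : ℕ → ℕ} {d j : ℕ} (h : ∀ i ≤ j, d ∣ x i) : d ∣ gapSum x j :=
  Finset.dvd_sum fun i hi => h i (by simpa [Nat.lt_succ_iff] using hi)

/-- From an unrepresented position there is a distance in `[D₀, D₀ + g]` to a weight that would
represent `N`. -/
lemma Unrepresented.exists_target {S : Set ℕ} {g K N k r d D₀ : ℕ} {x : ℕ → ℕ}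
    (h : Unrepresented S g K N k (k + r + 1) x) (hS : ∀ s ∈ S, d ∣ s) (hN : d ∣ N)
    (hsize : 2 * (D₀ + (K + 1) * g + g + r * g) ≤ N) :
    ∃ i D, K ≤ i ∧ i < k ∧ d ∣ D ∧ D₀ ≤ D ∧ D ≤ D₀ + g ∧
      gapSum x i + (gapSum x (k + r) + D) = N := by
  obtain ⟨hx, hk1, hk2, -⟩ := h
  have hKk : K < k := by
    by_contra hcon
    have h1 := gapSum_le (x := x) (g := g) (k := k) fun i hi => (hx i (by omega)).2
    have : (k + 1) * g ≤ (K + 1) * g := Nat.mul_le_mul_right _ (by omega)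
    omega
  have hw := gapSum_add_le (x := x) (g := g) (k := k) (r := r) fun i hi => (hx i (by omega)).2
  have hWK := gapSum_le (x := x) (g := g) (k := K) fun i hi => (hx i (by omega)).2
  have hkw : gapSum x k ≤ gapSum x (k + r) := gapSum_mono x (by omega)
  -- The target is the weight just before the first one that brings the remaining distance below
  -- `D₀`; one gap of size at most `g` separates the two, whence `D ≤ D₀ + g`.
  have hex : ∃ m, N < gapSum x m + gapSum x (k + r) + D₀ := ⟨k, by omega⟩
  classical
  set m := Nat.find hex with hm
  have hm1 : N < gapSum x m + gapSum x (k + r) + D₀ := Nat.find_spec hex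
  have hmk : m ≤ k := Nat.find_min' hex (by omega)
  have hKm : K < m := by
    by_contra hcon
    have := gapSum_mono x (not_lt.1 hcon)
    omega
  obtain ⟨i, hi⟩ : ∃ i, m = i + 1 := ⟨m - 1, by omega⟩
  have hm2 : ¬ N < gapSum x i + gapSum x (k + r) + D₀ := Nat.find_min hex (by omega)
  rw [hi, gapSum_succ] at hm1
  have hgi := (hx (i + 1) (by omega)).2
  refine ⟨i, N - gapSum x i - gapSum x (k + r), by omega, by omega, ?_, by omega, by omega,
    by omega⟩
  refine Nat.dvd_sub (Nat.dvd_sub hN ?_) ?_ <;>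
  exact dvd_gapSum fun j hj => hS _ (hx j (by omega)).1

/-- A path with small gaps in `S` that does not represent `N` is unrepresented at some `k ≤ N`. -/
lemma exists_unrepresented {S : Set ℕ} {g K N M : ℕ} {x : ℕ → ℕ} (hS : ∀ s ∈ S, 0 < s)
    (hx : ∀ i < N + 1 + M, x i ∈ S ∧ x i ≤ g)
    (h : ∀ i j, K ≤ i → i < j → gapSum x i + gapSum x j ≠ N) :
    ∃ k ≤ N, Unrepresented S g K N k (k + M + 1) x := by
  have hN : N < 2 * gapSum x N := by
    have := lt_gapSum (x := x) (k := N) fun i hi => hS _ (hx i (by omega)).1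
    omega
  have hex : ∃ k, N < 2 * gapSum x k := ⟨N, hN⟩
  classical
  have hkN := Nat.find_min' hex hN
  refine ⟨Nat.find hex, hkN, fun i hi => hx i (by omega), Nat.find_spec hex, ?_,
    fun i j hi hij _ => h i j hi hij⟩
  rcases hk : Nat.find hex with _ | k
  · have := (hx 0 (by omega)).2
    simp only [gapSum, zero_add, Finset.sum_range_one]
    omega
  · have h1 : ¬ N < 2 * gapSum x k := Nat.find_min hex (by omega)
    have := (hx (k + 1) (by omega)).2
    rw [gapSum_succ]
    omega

/-! ### Failure probability for a single `N`. -/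

section Probability

variable {Ω : Type*} [MeasurableSpace Ω] {μ : Measure Ω} [IsProbabilityMeasure μ]
  {X : ℕ → Ω → ℕ} {ν : Measure ℕ}

/-- Each block of `T` gaps gives a new attempt: given the history, a continuation of length at most
`T` represents `N` with probability at least `q`. The index `k` is deterministic here; a union bound
over `k` follows later. -/
lemma measure_unrepresented_le (hm : ∀ i, Measurable (X i)) (hi : iIndepFun X μ)
    (hl : ∀ i, μ.map (X i) = ν) {S : Set ℕ} {g K N d D₀ T J : ℕ} {q : ℝ≥0∞}
    (hS : ∀ s ∈ S, d ∣ s) (hN : d ∣ N)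
    (hq : ∀ D, d ∣ D → D₀ ≤ D → D ≤ D₀ + g →
      ∃ l : List ℕ, l.sum = D ∧ l.length ≤ T ∧ q ≤ (l.map fun a => ν {a}).prod)
    (hsize : 2 * (D₀ + (K + 1) * g + g + J * T * g) ≤ N) (k : ℕ) :
    ∀ j ≤ J, μ {ω | Unrepresented S g K N k (k + j * T + 1) fun i => X i ω} ≤ (1 - q) ^ j := by
  intro j
  induction j with
  | zero => simpa using prob_le_one
  | succ j ih =>
    intro hj
    rw [pow_succ']
    refine (measure_le_of_forbidden_continuation (n := k + j * T + 1) (q := q) hm hi hl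
      (A := {ω | Unrepresented S g K N k (k + j * T + 1) fun i => X i ω}) ?_ ?_ ?_).trans
      (mul_le_mul_right (ih (by omega)) _)
    · exact fun ω hω => Unrepresented.mono (by gcongr; omega) hω
    · exact fun ω hω ω' h => Unrepresented.congr (by omega) hω (gapHistory_eq_iff.1 h)
    · intro ω hω
      have hjT : j * T * g ≤ J * T * g := by gcongr; omega
      obtain ⟨i, D, hKi, hik, hdD, hD1, hD2, hsum⟩ :=
        Unrepresented.exists_target (D₀ := D₀) hω hS hN (by omega)
      obtain ⟨l, hlsum, hlen, hlq⟩ := hq D hdD hD1 hD2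
      refine ⟨l, hlq, fun ω' hω' hbad => ?_⟩
      obtain ⟨h1, h2⟩ := gapHistory_eq_append hω'
      rw [gapHistory_eq_iff] at h1
      refine hbad.2.2.2 i (k + j * T + l.length) hKi (by omega) (by rw [add_mul]; omega) ?_
      rw [gapSum_add_list h2, hlsum, ← hsum]
      congr 1
      · exact gapSum_congr fun a ha => h1 a (by omega)
      · congr 1
        exact gapSum_congr fun a ha => h1 a (by omega)

/-- The probability that `N` is not a sum of two distinct weights of index at least `K`. -/
lemma measure_not_sum_two_le (hm : ∀ i, Measurable (X i)) (hi : iIndepFun X μ)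
    (hl : ∀ i, μ.map (X i) = ν) {S : Set ℕ} {g K N d D₀ T J : ℕ} {q : ℝ≥0∞}
    (hS : ∀ s ∈ S, d ∣ s) (hS0 : ∀ s ∈ S, 0 < s) (hSν : ν Sᶜ = 0) (hN : d ∣ N)
    (hq : ∀ D, d ∣ D → D₀ ≤ D → D ≤ D₀ + g →
      ∃ l : List ℕ, l.sum = D ∧ l.length ≤ T ∧ q ≤ (l.map fun a => ν {a}).prod)
    (hsize : 2 * (D₀ + (K + 1) * g + g + J * T * g) ≤ N) :
    μ {ω | ∀ i j, K ≤ i → i < j → weight X ω i + weight X ω j ≠ N} ≤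
      ((N + 1 + J * T : ℕ) : ℝ≥0∞) * ν (Set.Ioi g) + ((N + 1 : ℕ) : ℝ≥0∞) * (1 - q) ^ J := by
  have hcover : {ω | ∀ i j, K ≤ i → i < j → weight X ω i + weight X ω j ≠ N} ⊆
      (⋃ i ∈ Finset.range (N + 1 + J * T), X i ⁻¹' (Sᶜ ∪ Set.Ioi g)) ∪
      ⋃ k ∈ Finset.range (N + 1),
        {ω | Unrepresented S g K N k (k + J * T + 1) fun i => X i ω} := by
    intro ω hω
    by_cases hx : ∀ i < N + 1 + J * T, X i ω ∈ S ∧ X i ω ≤ g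
    · obtain ⟨k, hk, h⟩ := exists_unrepresented hS0 hx hω
      refine Or.inr (Set.mem_iUnion₂.2 ⟨k, by simpa [Nat.lt_succ_iff] using hk, h⟩)
    · push Not at hx
      obtain ⟨i, hi, h⟩ := hx
      refine Or.inl (Set.mem_iUnion₂.2 ⟨i, by simpa using hi, ?_⟩)
      by_cases hXS : X i ω ∈ S
      · exact Or.inr (h hXS)
      · exact Or.inl hXS
  refine (measure_mono hcover).trans ((measure_union_le _ _).trans (add_le_add ?_ ?_))
  · refine (measure_biUnion_finset_le _ _).trans ?_
    refine (Finset.sum_le_card_nsmul _ _ (ν (Set.Ioi g)) fun i _ => ?_).trans_eq ?_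
    · rw [← Measure.map_apply (hm i) (Set.to_countable _).measurableSet, hl i]
      exact (measure_union_le _ _).trans (by rw [hSν, zero_add])
    · simp [nsmul_eq_mul]
  · refine (measure_biUnion_finset_le _ _).trans ?_
    refine (Finset.sum_le_card_nsmul _ _ _ fun k _ =>
      measure_unrepresented_le hm hi hl hS hN hq hsize k J le_rfl).trans_eq ?_
    simp [nsmul_eq_mul]

end Probability

/-! ### Likely ways to cover a prescribed distance. -/

/-- Every large multiple `D` of the gcd of the support is a sum of support points whose
probabilities have a product of order at least `exp (-ρ * D)`, where `exp (-ρ * s₀) = ν {s₀}`. -/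
lemma exists_list_sum_eq_of_ge {ν : Measure ℕ} [IsProbabilityMeasure ν] (h0 : ν {0} = 0) {s₀ : ℕ}
    (hs : ν {s₀} ≠ 0) :
    ∃ (c : ℝ) (D₀ : ℕ), 0 < c ∧ ∀ D ≥ D₀, Nat.setGcd {s | ν {s} ≠ 0} ∣ D →
      ∃ l : List ℕ, l.sum = D ∧ l.length ≤ D ∧
        ENNReal.ofReal (c * Real.exp (-(-Real.log (ν.real {s₀}) / s₀ * D))) ≤
          (l.map fun a => ν {a}).prod := by
  set S : Set ℕ := {s | ν {s} ≠ 0} with hSdef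
  have hS0 : ∀ s ∈ S, 1 ≤ s := fun s h => Nat.one_le_iff_ne_zero.2 fun h' => h (h' ▸ h0)
  have hs0 : 0 < s₀ := hS0 s₀ hs
  obtain ⟨D₀, hD₀⟩ := Nat.exists_mem_closure_of_ge S
  have hone (D : ℕ) : ∃ c : ℝ, 0 < c ∧ (D₀ ≤ D → Nat.setGcd S ∣ D →
      ∃ l : List ℕ, l.sum = D ∧ l.length ≤ D ∧
        ENNReal.ofReal c ≤ (l.map fun a => ν {a}).prod) := by
    by_cases h : D₀ ≤ D ∧ Nat.setGcd S ∣ D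
    · obtain ⟨l, hl, hsum⟩ := AddSubmonoid.exists_list_of_mem_closure (hD₀ D h.1 h.2)
      set P := (l.map fun a => ν {a}).prod with hP
      have hP0 : P ≠ 0 := by
        refine List.prod_ne_zero fun hmem => ?_
        obtain ⟨a, ha, ha0⟩ := List.mem_map.1 hmem
        exact hl a ha ha0
      have hPtop : P ≠ ⊤ := by
        have hle (l : List ℕ) : (l.map fun a => ν {a}).prod ≤ 1 := by
          induction l with
          | nil => simp
          | cons a l ih => simpa using mul_le_one' prob_le_one ih
        exact ne_top_of_le_ne_top ENNReal.one_ne_top (hle l)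
      refine ⟨P.toReal, ENNReal.toReal_pos hP0 hPtop, fun _ _ => ⟨l, hsum, ?_, ?_⟩⟩
      · rw [← hsum]
        exact List.length_le_sum_of_one_le l fun a ha => hS0 a (hl a ha)
      · rw [ENNReal.ofReal_toReal hPtop]
    · exact ⟨1, one_pos, fun h1 h2 => (h ⟨h1, h2⟩).elim⟩
  choose f hf0 hf using hone
  have hne : (Finset.range (D₀ + s₀)).Nonempty := Finset.nonempty_range_iff.2 (by omega)
  -- Subtracting copies of `s₀` brings `D` into the window `[D₀, D₀ + s₀)`, so finitely many
  -- constants suffice.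
  refine ⟨(Finset.range (D₀ + s₀)).inf' hne f, D₀, (Finset.lt_inf'_iff hne).2 fun i _ => hf0 i,
    fun D hD hdvd => ?_⟩
  set c := (Finset.range (D₀ + s₀)).inf' hne f
  have hc0 : 0 < c := (Finset.lt_inf'_iff hne).2 fun i _ => hf0 i
  set D₁ := D₀ + (D - D₀) % s₀ with hD₁
  set k := (D - D₀) / s₀ with hk
  have hDk : D = D₁ + k * s₀ := by
    have := Nat.mod_add_div (D - D₀) s₀
    rw [mul_comm, ← hk] at this
    omega
  have hlt : D₁ < D₀ + s₀ := by
    have := Nat.mod_lt (D - D₀) hs0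
    omega
  have hdvd₁ : Nat.setGcd S ∣ D₁ := by
    refine (Nat.dvd_add_left ((Nat.setGcd_dvd_of_mem hs).mul_left k)).1 ?_
    rwa [← hDk]
  obtain ⟨l, hsum, hlen, hprod⟩ := hf D₁ (Nat.le_add_right _ _) hdvd₁
  refine ⟨l ++ List.replicate k s₀, ?_, ?_, ?_⟩
  · simp [hsum, hDk]
  · have : k ≤ k * s₀ := Nat.le_mul_of_pos_right k hs0
    simp only [List.length_append, List.length_replicate]
    omega
  · have hp : 0 < ν.real {s₀} := ENNReal.toReal_pos hs (measure_ne_top _ _)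
    have hρ : 0 ≤ -Real.log (ν.real {s₀}) / s₀ :=
      div_nonneg (neg_nonneg.2 (Real.log_nonpos hp.le measureReal_le_one)) (Nat.cast_nonneg _)
    have hpow : ν {s₀} ^ k =
        ENNReal.ofReal (Real.exp (-(-Real.log (ν.real {s₀}) / s₀ * (k * s₀)))) := by
      have hs' : (s₀ : ℝ) ≠ 0 := by positivity
      rw [show -(-Real.log (ν.real {s₀}) / s₀ * (k * s₀)) = k * Real.log (ν.real {s₀}) by
        field_simp, Real.exp_nat_mul, Real.exp_log hp, ENNReal.ofReal_pow hp.le, measureReal_def,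
        ENNReal.ofReal_toReal (measure_ne_top _ _)]
    rw [List.map_append, List.prod_append, List.map_replicate, List.prod_replicate, hpow,
      ENNReal.ofReal_mul hc0.le]
    refine mul_le_mul' ?_ ?_
    · exact (ENNReal.ofReal_le_ofReal (Finset.inf'_le f (Finset.mem_range.2 hlt))).trans hprod
    · refine ENNReal.ofReal_le_ofReal (Real.exp_le_exp.2 ?_)
      have : (k : ℝ) * s₀ ≤ D := by
        exact_mod_cast hDk ▸ Nat.le_add_left _ _
      nlinarith

/-! ### Asymptotic comparisons. -/

lemma eventually_mul_log_le_rpow (α : ℝ) {ε : ℝ} (hε : 0 < ε) :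
    ∀ᶠ N : ℕ in Filter.atTop, α * Real.log N ≤ (N : ℝ) ^ ε := by
  have h := ((isLittleO_log_rpow_atTop hε).const_mul_left α).def one_pos
  filter_upwards [tendsto_natCast_atTop_atTop.eventually h] with N hN
  rw [one_mul, Real.norm_eq_abs, Real.norm_eq_abs,
    abs_of_nonneg (Real.rpow_nonneg (Nat.cast_nonneg N) ε)] at hN
  exact (le_abs_self _).trans hN

lemma eventually_const_le_rpow (C : ℝ) {ε : ℝ} (hε : 0 < ε) :
    ∀ᶠ N : ℕ in Filter.atTop, C ≤ (N : ℝ) ^ ε :=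
  ((tendsto_rpow_atTop hε).comp tendsto_natCast_atTop_atTop).eventually_ge_atTop C

lemma eventually_log_polynomial_le (D₀ K : ℕ) {α β : ℝ} (hα : 0 < α) (hβ0 : 0 < β) (hβ : β < 1) :
    ∀ᶠ N : ℕ in Filter.atTop,
      2 * (D₀ + (K + 1) * ⌊α * Real.log N⌋₊ + ⌊α * Real.log N⌋₊ +
        ⌊(N : ℝ) ^ β⌋₊ * (D₀ + ⌊α * Real.log N⌋₊) * ⌊α * Real.log N⌋₊) ≤ N := by
  -- With `g ≤ N ^ ε` the dominant term `J * g * g` is at most N^(β + 2ε), and β + 2ε < 1.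
  set ε := (1 - β) / 4 with hε
  have hε0 : 0 < ε := by rw [hε]; linarith
  have hε1 : 0 < 1 - (β + ε + ε) := by rw [hε]; linarith
  filter_upwards [eventually_mul_log_le_rpow α hε0, eventually_const_le_rpow D₀ hε0,
    eventually_const_le_rpow (2 * (K + 5)) hε1, Filter.eventually_ge_atTop 1] with N h1 h2 h3 hN
  have hN' : (1 : ℝ) ≤ N := by exact_mod_cast hN
  have hNpos : (0 : ℝ) < N := by linarith
  set g := ⌊α * Real.log N⌋₊ with hg
  set J := ⌊(N : ℝ) ^ β⌋₊
  set y := (N : ℝ) ^ ε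
  set z := (N : ℝ) ^ β
  have hgy : (g : ℝ) ≤ y :=
    (Nat.floor_le (mul_nonneg hα.le (Real.log_nonneg hN'))).trans h1
  have hJz : (J : ℝ) ≤ z := Nat.floor_le (by positivity)
  have hy1 : 1 ≤ y := Real.one_le_rpow hN' hε0.le
  have hz1 : 1 ≤ z := Real.one_le_rpow hN' hβ0.le
  have hyz : z * y * y = (N : ℝ) ^ (β + ε + ε) := by
    rw [Real.rpow_add hNpos, Real.rpow_add hNpos]
  have hylez : y ≤ z * y * y := by 
    exact le_mul_of_one_le_left (by linarith) (one_le_mul_of_one_le_of_one_le hz1 hy1)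
  have hlast : (J : ℝ) * (D₀ + g) * g ≤ 2 * (z * y * y) := by
    calc (J : ℝ) * (D₀ + g) * g ≤ z * (y + y) * y := by gcongr
      _ = 2 * (z * y * y) := by ring
  have hfin : 2 * ((K : ℝ) + 5) * (z * y * y) ≤ N := by
    calc 2 * ((K : ℝ) + 5) * (z * y * y) ≤
        (N : ℝ) ^ (1 - (β + ε + ε)) * (N : ℝ) ^ (β + ε + ε) := by
          rw [hyz]; gcongr
      _ = N := by rw [← Real.rpow_add hNpos]; simp
  have hK : ((K : ℝ) + 1) * g ≤ (K + 1) * (z * y * y) := by gcongr; linarith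
  have : (2 * (D₀ + (K + 1) * g + g + J * (D₀ + g) * g) : ℝ) ≤ N := by nlinarith
  exact_mod_cast this

lemma eventually_mul_exp_neg_rpow_le {c γ : ℝ} (hc : 0 < c) (hγ : 0 < γ) :
    ∀ᶠ N : ℕ in Filter.atTop,
      ((N : ℝ) + 1) * Real.exp (-(c * (N : ℝ) ^ γ)) ≤ (N : ℝ) ^ (-2 : ℝ) := by
  -- At N^γ the exponent -4/γ gives N^(-4), which absorbs N + 1 ≤ N².
  have h := (isLittleO_exp_neg_mul_rpow_atTop hc (-4 / γ)).def one_pos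
  have ht := ((tendsto_rpow_atTop hγ).comp tendsto_natCast_atTop_atTop).eventually h
  filter_upwards [ht, Filter.eventually_ge_atTop 2] with N hN hN2
  have hN2' : (2 : ℝ) ≤ N := by exact_mod_cast hN2
  have hNpos : (0 : ℝ) < N := by linarith
  simp only [Function.comp, one_mul, Real.norm_eq_abs, Real.abs_exp] at hN
  rw [abs_of_nonneg (by positivity), ← Real.rpow_mul hNpos.le,
    mul_div_cancel₀ _ hγ.ne'] at hN
  have e4 : (N : ℝ) ^ (-2 : ℝ) = N ^ 2 * (N : ℝ) ^ (-4 : ℝ) := by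
    rw [← Real.rpow_natCast, ← Real.rpow_add hNpos]; norm_num
  rw [e4, ← neg_mul]
  gcongr
  nlinarith

/-! ### From two weights to `m` weights. -/

lemma isAsymptoticallyComplete_of_sum_two {Ω : Type*} {X : ℕ → Ω → ℕ} {ω : Ω} {d m : ℕ} (hm : 2 ≤ m)
    (hpos : ∀ i, 0 < X i ω) (hd : ∀ i, d ∣ X i ω)
    (h : ∀ᶠ N : ℕ in Filter.atTop, d ∣ N →
      ∃ i j, m - 2 ≤ i ∧ i < j ∧ weight X ω i + weight X ω j = N) :
    IsAsymptoticallyComplete m (weight X ω) := by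
  have hw0 (i : ℕ) : 0 < weight X ω i :=
    Finset.sum_pos (fun j _ => hpos j) (Finset.nonempty_range_iff.2 (Nat.succ_ne_zero i))
  have hdw (i : ℕ) : d ∣ weight X ω i := Finset.dvd_sum fun j _ => hd j
  refine ⟨gapSum_mono fun i => X i ω, hw0, ?_⟩
  set e := Nat.setGcd (Set.range (weight X ω)) with he
  -- Divisibility is enough; equality of the two gcds is not needed.
  have hde : d ∣ e := Nat.dvd_setGcd_iff.2 (by rintro _ ⟨i, rfl⟩; exact hdw i)
  have he0 : 0 < e :=
    Nat.pos_of_dvd_of_pos (Nat.setGcd_dvd_of_mem (Set.mem_range_self 0)) (hw0 0)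
  obtain ⟨N₀, hN₀⟩ := Filter.eventually_atTop.1 h
  set A := ∑ i ∈ Finset.range (m - 2), weight X ω i with hA
  have hdA : d ∣ A := Finset.dvd_sum fun i _ => hdw i
  refine ⟨N₀ + A, fun n hn => ?_⟩
  have hne : n ≤ n * e := Nat.le_mul_of_pos_right n he0
  obtain ⟨i, j, hi, hij, hsum⟩ := hN₀ (n * e - A) (by omega)
    (Nat.dvd_sub (hde.mul_left n) hdA)
  have hj : j ∉ Finset.range (m - 2) := by simp; omega
  have hi' : i ∉ insert j (Finset.range (m - 2)) := by simp; omega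
  refine ⟨insert i (insert j (Finset.range (m - 2))), ?_, ?_⟩
  · rw [Finset.card_insert_of_notMem hi', Finset.card_insert_of_notMem hj, Finset.card_range]
    omega
  · rw [Finset.sum_insert hi', Finset.sum_insert hj]
    omega

lemma ae_mem_support {Ω : Type*} [MeasurableSpace Ω] {μ : Measure Ω} {X : ℕ → Ω → ℕ}
    {ν : Measure ℕ} (hm : ∀ i, Measurable (X i)) (hl : ∀ i, μ.map (X i) = ν) :
    ∀ᵐ ω ∂μ, ∀ i, ν {X i ω} ≠ 0 := by
  rw [ae_all_iff]
  intro i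
  have h : ∀ᵐ s ∂ν, ν {s} ≠ 0 := by
    rw [ae_iff_of_countable]
    exact fun s hs => hs
  rw [← hl i] at h
  simpa only [hl i] using ae_of_ae_map (hm i).aemeasurable h

/-! ### Choice of parameters and Borel–Cantelli. -/

section Probability

variable {Ω : Type*} [MeasurableSpace Ω] {μ : Measure Ω} [IsProbabilityMeasure μ]
  {X : ℕ → Ω → ℕ} {ν : Measure ℕ}

lemma one_sub_ofReal_pow_le {q : ℝ} (hq : 0 ≤ q) (J : ℕ) :
    (1 - ENNReal.ofReal q) ^ J ≤ ENNReal.ofReal (Real.exp (-(q * J))) := by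
  rw [← ENNReal.ofReal_one, ← ENNReal.ofReal_sub _ hq,
    show -(q * J) = J * -q by ring, Real.exp_nat_mul, ENNReal.ofReal_pow (Real.exp_nonneg _)]
  gcongr
  exact Real.one_sub_le_exp_neg q

lemma measure_Ioi_floor_log_le [IsProbabilityMeasure ν] {t : ℝ} (ht : 0 < t)
    (hint : Integrable (fun s : ℕ => Real.exp (t * s)) ν) (α : ℝ) {N : ℕ} (hN : 0 < N) :
    ν (Set.Ioi ⌊α * Real.log N⌋₊) ≤
      ENNReal.ofReal ((N : ℝ) ^ (-(α * t)) * mgf (fun s : ℕ => (s : ℝ)) ν t) := by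
  have h := measure_ge_le_exp_mul_mgf (α * Real.log N) ht.le hint
  have hN' : (0 : ℝ) < N := by exact_mod_cast hN
  have he : Real.exp (-t * (α * Real.log N)) = (N : ℝ) ^ (-(α * t)) := by
    rw [Real.rpow_def_of_pos hN']; ring_nf
  rw [he] at h
  rw [← ofReal_measureReal]
  refine ENNReal.ofReal_le_ofReal ((measureReal_mono fun s hs => ?_).trans h)
  exact (Nat.lt_of_floor_lt hs).le

/-- Almost surely all large multiples of the gcd of the support are sums of two distinct weights of
index at least `K`. -/
lemma ae_eventually_sum_two (hν : IsAdmissibleGapLaw ν) (hm : ∀ i, Measurable (X i))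
    (hi : iIndepFun X μ) (hl : ∀ i, μ.map (X i) = ν) (K : ℕ) :
    ∀ᵐ ω ∂μ, ∀ᶠ N : ℕ in Filter.atTop, Nat.setGcd {s | ν {s} ≠ 0} ∣ N →
      ∃ i j, K ≤ i ∧ i < j ∧ weight X ω i + weight X ω j = N := by
  have := hν.isProbabilityMeasure
  obtain ⟨t, ht0, ht, hint⟩ := exists_integrable_exp_of_lt_mgfRadius hν.radius
  obtain ⟨s₀, hs₀, hρt⟩ := gapRate_lt_exists (show gapRate ν < t / 2 by linarith)
  obtain ⟨c, D₀, hc, hlist⟩ := exists_list_sum_eq_of_ge hν.pos hs₀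
  set ρ := -Real.log (ν.real {s₀}) / s₀ with hρ
  have hρ0 : 0 ≤ ρ := div_nonneg (neg_nonneg.2
    (Real.log_nonpos measureReal_nonneg measureReal_le_one)) (Nat.cast_nonneg _)
  set S : Set ℕ := {s | ν {s} ≠ 0} with hS
  -- This `α` lies strictly between 2/t and 1/ρ (no upper constraint when ρ = 0).
  set α := 4 / (t + 2 * ρ) with hα
  have hα0 : 0 < α := by positivity
  have hαt : 2 < α * t := by
    rw [hα, div_mul_eq_mul_div, lt_div_iff₀ (by positivity)]; linarith
  have hαρ : α * ρ < 1 := by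
    rw [hα, div_mul_eq_mul_div, div_lt_one (by positivity)]; linarith
  have hαρ0 : 0 ≤ α * ρ := by positivity
  -- The midpoint of αρ and 1, so that γ = β - αρ > 0.
  set β := (1 + α * ρ) / 2 with hβ
  set γ := (1 - α * ρ) / 2 with hγ
  have hγ0 : 0 < γ := by rw [hγ]; linarith
  have hβ0 : 0 < β := by rw [hβ]; linarith
  have hβ1 : β < 1 := by rw [hβ]; linarith
  set c' := c * Real.exp (-(ρ * D₀)) / 2 with hc'
  have hc'0 : 0 < c' := by positivity
  set M := mgf (fun s : ℕ => (s : ℝ)) ν t with hM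
  have hM0 : 0 ≤ M := mgf_nonneg
  have hev := ((eventually_log_polynomial_le D₀ K hα0 hβ0 hβ1).and
    ((eventually_mul_exp_neg_rpow_le hc'0 hγ0).and ((eventually_const_le_rpow 2 hβ0).and
    ((Real.tendsto_log_atTop.comp tendsto_natCast_atTop_atTop).eventually_ge_atTop (1 / α)))))
  obtain ⟨N₁, hN₁⟩ := Filter.eventually_atTop.1 hev
  set F : ℕ → Set Ω := fun N => {ω | (N₁ ≤ N ∧ 1 ≤ N ∧ Nat.setGcd S ∣ N) ∧
    ∀ i j, K ≤ i → i < j → weight X ω i + weight X ω j ≠ N} with hF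
  set u : ℕ → ℝ := fun N => 3 * M * (N : ℝ) ^ (1 - α * t) + (N : ℝ) ^ (-2 : ℝ) with hu
  have hu_sum : Summable u :=
    ((Real.summable_nat_rpow.2 (by linarith)).mul_left _).add
      (Real.summable_nat_rpow.2 (by norm_num))
  have hbound (N : ℕ) : μ (F N) ≤ ENNReal.ofReal (u N) := by
    by_cases hN : N₁ ≤ N ∧ 1 ≤ N ∧ Nat.setGcd S ∣ N
    swap
    · have : F N = ∅ := Set.eq_empty_of_forall_notMem fun ω h => hN h.1
      simp [this]
    obtain ⟨hNN₁, hN1, hdvd⟩ := hN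
    obtain ⟨hsize, hexp, hz2, hlog⟩ := hN₁ N hNN₁
    have hN1' : (1 : ℝ) ≤ N := by exact_mod_cast hN1
    have hNpos : (0 : ℝ) < N := by linarith
    set g := ⌊α * Real.log N⌋₊ with hg
    set J := ⌊(N : ℝ) ^ β⌋₊ with hJ
    have hglog : (g : ℝ) ≤ α * Real.log N :=
      Nat.floor_le (mul_nonneg hα0.le (Real.log_nonneg hN1'))
    have hg1 : 1 ≤ g := by
      refine Nat.le_floor ?_
      have : 1 / α ≤ Real.log N := hlog
      rw [div_le_iff₀ hα0] at this
      push_cast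
      linarith
    set q := c * Real.exp (-(ρ * (D₀ + g))) with hq
    have hq0 : 0 ≤ q := by positivity
    -- All attempts together use at most `N` further gaps, so at most 3N gaps need the cap.
    have hJT : J * (D₀ + g) ≤ N := by
      have : J * (D₀ + g) ≤ J * (D₀ + g) * g := Nat.le_mul_of_pos_right _ hg1
      omega
    have hmain := measure_not_sum_two_le (S := S) (g := g) (K := K) (N := N)
      (d := Nat.setGcd S) (D₀ := D₀) (T := D₀ + g) (J := J) (q := ENNReal.ofReal q) hm hi hl
      (fun s hs => Nat.setGcd_dvd_of_mem hs)
      (fun s hs => Nat.pos_of_ne_zero fun h => hs (h ▸ hν.pos))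
      (by
        have : Sᶜ = ⋃ s : (Sᶜ : Set ℕ), {s.1} := by ext; simp
        rw [this, measure_iUnion_null_iff]
        exact fun s => not_not.1 s.2) hdvd
      (by
        intro D hD hD1 hD2
        obtain ⟨l, h1, h2, h3⟩ := hlist D hD1 hD
        refine ⟨l, h1, by omega, le_trans (ENNReal.ofReal_le_ofReal ?_) h3⟩
        have : (D : ℝ) ≤ D₀ + g := by exact_mod_cast hD2
        rw [hq]
        gcongr) hsize
    -- The factor 1/2 in `c'` pays for the floor in `J`, since N^β ≥ 2.
    have hqJ : c' * (N : ℝ) ^ γ ≤ q * J := by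
      have h1 : c * Real.exp (-(ρ * D₀)) * (N : ℝ) ^ (-(α * ρ)) ≤ q := by
        rw [hq, Real.rpow_def_of_pos hNpos, mul_assoc, ← Real.exp_add]
        gcongr
        nlinarith
      have h2 : (N : ℝ) ^ β / 2 ≤ J := by
        have := Nat.lt_floor_add_one ((N : ℝ) ^ β)
        linarith
      calc c' * (N : ℝ) ^ γ = c * Real.exp (-(ρ * D₀)) * (N : ℝ) ^ (-(α * ρ)) *
            ((N : ℝ) ^ β / 2) := by
            have : (N : ℝ) ^ γ = (N : ℝ) ^ (-(α * ρ)) * (N : ℝ) ^ β := by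
              rw [← Real.rpow_add hNpos, hγ, hβ]; ring_nf
            rw [this, hc']; ring
        _ ≤ q * J := by gcongr
    have hfirst : ((N + 1 + J * (D₀ + g) : ℕ) : ℝ≥0∞) * ν (Set.Ioi g) ≤
        ENNReal.ofReal (3 * M * (N : ℝ) ^ (1 - α * t)) := by
      have h3 : ((N + 1 + J * (D₀ + g) : ℕ) : ℝ≥0∞) ≤ ENNReal.ofReal (3 * N) := by
        rw [← ENNReal.ofReal_natCast]
        refine ENNReal.ofReal_le_ofReal ?_
        have : N + 1 + J * (D₀ + g) ≤ 3 * N := by omega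
        exact_mod_cast this
      refine (mul_le_mul' h3 (measure_Ioi_floor_log_le ht0 hint α hN1)).trans_eq ?_
      rw [← ENNReal.ofReal_mul (by positivity)]
      congr 1
      rw [sub_eq_add_neg, Real.rpow_add hNpos, Real.rpow_one]
      ring
    have hsecond : ((N + 1 : ℕ) : ℝ≥0∞) * (1 - ENNReal.ofReal q) ^ J ≤
        ENNReal.ofReal ((N : ℝ) ^ (-2 : ℝ)) := by
      refine (mul_le_mul_right (one_sub_ofReal_pow_le hq0 J) _).trans ?_
      rw [← ENNReal.ofReal_natCast, ← ENNReal.ofReal_mul (Nat.cast_nonneg _)]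
      refine ENNReal.ofReal_le_ofReal (le_trans ?_ hexp)
      push_cast
      gcongr
    calc μ (F N) ≤ _ := (measure_mono fun ω h => h.2).trans hmain
      _ ≤ _ := add_le_add hfirst hsecond
      _ = ENNReal.ofReal (u N) := (ENNReal.ofReal_add (by positivity) (by positivity)).symm
  have hsum : ∑' N, μ (F N) ≠ ⊤ :=
    ne_top_of_le_ne_top hu_sum.tsum_ofReal_ne_top (ENNReal.tsum_le_tsum hbound)
  filter_upwards [ae_eventually_notMem hsum] with ω hω
  filter_upwards [hω, Filter.eventually_ge_atTop N₁, Filter.eventually_ge_atTop 1]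
    with N hN h1 h2 hd
  by_contra hcon
  push Not at hcon
  exact hN ⟨⟨h1, h2, hd⟩, hcon⟩

end Probability

theorem theorem1p3 :
    (∀ (ν : Measure ℕ), IsAdmissibleGapLaw ν →
      ∀ (Ω : Type*) [MeasurableSpace Ω] (μ : Measure Ω) [IsProbabilityMeasure μ]
        (X : ℕ → Ω → ℕ), (∀ i, Measurable (X i)) → iIndepFun X μ → (∀ i, μ.map (X i) = ν) →
        ∀ m : ℕ, 2 ≤ m → ∀ᵐ ω ∂μ, IsAsymptoticallyComplete m (weight X ω)) ∧
    (∀ r : ℝ≥0, 0 < r → IsAdmissibleGapLaw ((poissonMeasure r).map (fun k => k + 1))) ∧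
    (∀ p : unitInterval, (Real.sqrt 5 - 1) / 2 < (p : ℝ) →
      IsAdmissibleGapLaw ((geometricMeasure p).map (fun k => k + 1))) := by
  refine ⟨?_, fun r _ => isAdmissibleGapLaw_poisson r, isAdmissibleGapLaw_geometric⟩
  intro ν hν Ω _ μ _ X hX hi hl m hm
  filter_upwards [ae_eventually_sum_two hν hX hi hl (m - 2), ae_mem_support hX hl] with ω h hsupp
  exact isAsymptoticallyComplete_of_sum_two hm
    (fun i => Nat.pos_of_ne_zero fun h0 => hsupp i (h0 ▸ hν.pos))
    (fun i => Nat.setGcd_dvd_of_mem (hsupp i)) h
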